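/- Graphs are finite multigraphs $G=(V,E,\phi)$; loops and parallel edges are allowed. For $C\subseteq E$ let $G\langle C\rangle$ be the subgraph with edge set $C$ whose vertices are the ends of the edges in $C$. The bicircular matroid $M_1(G)$ is the matroid on $E$ whose circuits are the sets $C\subseteq E$ such that $|C|-|V(G\langle C\rangle)|=1$ and $G\langle C\rangle$ has no isolated vertex, no leaf (vertex of degree $1$) and no component that is a cycle. A graph is 3-connected if it is simple, has at least four vertices, and remains connected after the deletion of any set of at most two vertices. Two graphs $G=(V,E,\phi)$ and $G'=(V',E,\phi')$ with the same edge set are strongly isomorphic if there is a bijection $\nu:V\to V'$ such that for all $e\in E$ and $x,y\in V$: $\phi(e)=\{x,y\}$ if and only if $\phi'(e)=\{\nu(x),\nu(y)\}$. Theorem. Let $G$ be a 3-connected graph that is not isomorphic to the complete graph $K_4$. Then $G$ is uniquely defined by its bicircular matroid: if $G'$ is a graph without isolated vertices and $M_1(G')=M_1(G)$, then $G$ and $G'$ are strongly isomorphic. -/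

import Mathlib

open scoped Graph

namespace Graph

/-- The degree of a vertex of a multigraph: every incident edge counts once, every loop twice. -/
noncomputable def deg {α β : Type*} (G : Graph α β) (x : α) : ℕ∞ :=
  (G.incidenceSet x).encard + (G.loopSet x).encard

/-- `G` has no isolated vertex: every vertex is incident to some edge. -/
def NoIsolated {α β : Type*} (G : Graph α β) : Prop :=
  ∀ x ∈ V(G), (G.incidenceSet x).Nonempty

/-- `G⟨X⟩`: the edges are those of `X`, the vertices are the ends of these edges. -/
def edgeInduce {α β : Type*} (G : Graph α β) (X : Set β) : Graph α β :=
  (G.restrict X).induce {x | ∃ e ∈ X, G.Inc e x}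

/-- `Δ(G) = |E(G)| - |V(G)|` (for finite graphs). -/
noncomputable def excess {α β : Type*} (G : Graph α β) : ℤ :=
  (E(G).ncard : ℤ) - (V(G).ncard : ℤ)

/-- A (finite) graph is a cacti-graph if it has no isolated vertices, no leaves and no component
that is a cycle. A component of a finite multigraph is a cycle when all its vertices have degree
two; a loop and a pair of parallel edges are cycles. -/
structure IsCactiGraph {α β : Type*} (G : Graph α β) : Prop where
  noIsolated : G.NoIsolated
  noLeaf : ∀ x ∈ V(G), G.deg x ≠ 1
  noCycleComponent : ∀ c : G.toSimpleGraph.ConnectedComponent, ¬ ∀ x ∈ c.supp, G.deg x = 2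

/-- `C_k(G)`: the finite edge sets `C` such that `G⟨C⟩` is a cacti-graph with
`|C| - |V(G⟨C⟩)| = k`. -/
def circularSets {α β : Type*} (G : Graph α β) (k : ℕ) : Set (Set β) :=
  {C | C ⊆ E(G) ∧ C.Finite ∧ (G.edgeInduce C).excess = k ∧ (G.edgeInduce C).IsCactiGraph}

/-- The set of ends of the edges in `X`, i.e. the vertex set of `G⟨X⟩`. -/
def ends {α β : Type*} (G : Graph α β) (X : Set β) : Set α := {x | ∃ e ∈ X, G.Inc e x}

lemma ends_mono {α β : Type*} (G : Graph α β) {X Y : Set β} (h : X ⊆ Y) :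
    G.ends X ⊆ G.ends Y := fun _ ⟨e, he, hx⟩ ↦ ⟨e, h he, hx⟩

lemma ends_finite {α β : Type*} (G : Graph α β) {X : Set β} (h : X.Finite) :
    (G.ends X).Finite := by
  have : G.ends X = ⋃ e ∈ X, {x | G.Inc e x} := by
    ext x; simp [ends]
  rw [this]
  refine h.biUnion fun e _ ↦ ?_
  by_cases he : e ∈ E(G)
  · obtain ⟨a, b, hab⟩ := G.exists_isLink_of_mem_edgeSet he
    exact (Set.toFinite {a, b}).subset fun x hx ↦ by
      simpa using Inc.eq_or_eq_of_isLink hx hab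
  · simp [he]

lemma ends_union {α β : Type*} (G : Graph α β) (X Y : Set β) :
    G.ends (X ∪ Y) = G.ends X ∪ G.ends Y := by
  ext x; simp [ends, or_and_right, exists_or]

@[simp] lemma vertexSet_edgeInduce {α β : Type*} (G : Graph α β) (X : Set β) :
    V(G.edgeInduce X) = G.ends X := rfl

lemma edgeInduce_isLink {α β : Type*} {G : Graph α β} {X : Set β} {e : β} {x y : α} :
    (G.edgeInduce X).IsLink e x y ↔ e ∈ X ∧ G.IsLink e x y := by
  simp only [edgeInduce, induce_isLink, restrict_isLink, Set.mem_ofPred_eq]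
  exact ⟨fun h ↦ h.1, fun h ↦ ⟨h, ⟨e, h.1, h.2.inc_left⟩, ⟨e, h.1, h.2.inc_right⟩⟩⟩

lemma edgeInduce_inc {α β : Type*} {G : Graph α β} {X : Set β} {e : β} {x : α} :
    (G.edgeInduce X).Inc e x ↔ e ∈ X ∧ G.Inc e x := by
  simp [Inc, edgeInduce_isLink]

lemma edgeSet_edgeInduce {α β : Type*} {G : Graph α β} {X : Set β} (h : X ⊆ E(G)) :
    E(G.edgeInduce X) = X := by
  ext e
  rw [edge_mem_iff_exists_isLink]
  simp only [edgeInduce_isLink, exists_and_left]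
  exact ⟨fun h ↦ h.1, fun he ↦ ⟨he, G.exists_isLink_of_mem_edgeSet (h he)⟩⟩

/-- A set of vertices of degree at most two carries at most as many edges as vertices. -/
lemma ncard_le_of_deg_eq_two {α β : Type*} (H : Graph α β) {K : Set β} {U : Set α}
    (hK : K.Finite) (hU : U.Finite) (hdeg : ∀ x ∈ U, H.deg x = 2)
    (hends : ∀ e ∈ K, ∃ x ∈ U, ∃ y ∈ U, H.IsLink e x y) : K.ncard ≤ U.ncard := by
  classical
  lift K to Finset β using hK
  lift U to Finset α using hU
  rw [Set.ncard_coe_finset, Set.ncard_coe_finset]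
  have h1 : ∑ x ∈ U, ∑ e ∈ K, ((if H.Inc e x then 1 else 0) + (if H.IsLoopAt e x then 1 else 0))
      ≤ ∑ x ∈ U, 2 := by
    refine Finset.sum_le_sum fun x hx ↦ ?_
    rw [Finset.sum_add_distrib, ← Finset.card_filter, ← Finset.card_filter]
    have h := hdeg x (by simpa using hx)
    have ha : ((K.filter fun e ↦ H.Inc e x).card : ℕ∞) ≤ (H.incidenceSet x).encard := by
      rw [← Set.encard_coe_eq_coe_finsetCard]
      exact Set.encard_le_encard fun e he ↦ by simpa using (Finset.mem_filter.1 he).2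
    have hb : ((K.filter fun e ↦ H.IsLoopAt e x).card : ℕ∞) ≤ (H.loopSet x).encard := by
      rw [← Set.encard_coe_eq_coe_finsetCard]
      exact Set.encard_le_encard fun e he ↦ by simpa using (Finset.mem_filter.1 he).2
    have := (add_le_add ha hb).trans_eq h
    exact_mod_cast this
  have h2 : ∑ e ∈ K, 2 ≤
      ∑ e ∈ K, ∑ x ∈ U, ((if H.Inc e x then 1 else 0) + (if H.IsLoopAt e x then 1 else 0)) := by
    refine Finset.sum_le_sum fun e he ↦ ?_
    obtain ⟨x, hx, y, hy, hxy⟩ := hends e (by simpa using he)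
    rw [Finset.sum_add_distrib, ← Finset.card_filter, ← Finset.card_filter]
    have hxm : x ∈ U.filter fun x ↦ H.Inc e x := by
      simpa using ⟨hx, hxy.inc_left⟩
    have hym : y ∈ U.filter fun x ↦ H.Inc e x := by
      simpa using ⟨hy, hxy.inc_right⟩
    by_cases hne : x = y
    · subst hne
      have hl : x ∈ U.filter fun x ↦ H.IsLoopAt e x := by
        simpa using ⟨hx, hxy⟩
      have := Finset.card_pos.2 ⟨x, hxm⟩
      have := Finset.card_pos.2 ⟨x, hl⟩
      omega
    · have : 1 < (U.filter fun x ↦ H.Inc e x).card :=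
        Finset.one_lt_card.2 ⟨x, hxm, y, hym, hne⟩
      omega
  rw [Finset.sum_comm] at h1
  have := h2.trans h1
  simp at this
  omega

/-- A finite edge set that has more edges than ends, and is minimal so, is a member of `C_1(G)`. -/
lemma mem_circularSets_of_minimal {α β : Type*} (G : Graph α β) {J : Set β} (hJE : J ⊆ E(G))
    (hJ : J.Finite) (hlt : (G.ends J).ncard < J.ncard)
    (hmin : ∀ L ⊂ J, L.ncard ≤ (G.ends L).ncard) : J ∈ G.circularSets 1 := by
  have hfin := G.ends_finite hJ
  have hne : J.Nonempty := by
    rw [Set.nonempty_iff_ne_empty]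
    rintro rfl
    simp at hlt
  have hcard : J.ncard = (G.ends J).ncard + 1 := by
    obtain ⟨e, he⟩ := hne
    have h1 := hmin (J \ {e}) (Set.sdiff_singleton_ssubset.2 he)
    have h2 := Set.ncard_le_ncard (G.ends_mono (Set.sdiff_subset (s := J) (t := {e}))) hfin
    have h3 := Set.ncard_sdiff_singleton_add_one he hJ
    omega
  refine ⟨hJE, hJ, ?_, ?_, ?_, ?_⟩
  · rw [excess, edgeSet_edgeInduce hJE, vertexSet_edgeInduce]
    omega
  · rintro x ⟨e, he, hx⟩
    exact ⟨e, edgeInduce_inc.2 ⟨he, hx⟩⟩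
  · rintro x hx hdeg
    rw [vertexSet_edgeInduce] at hx
    obtain ⟨e, he, hex⟩ := id hx
    have hone : ((G.edgeInduce J).incidenceSet x).encard ≤ 1 := hdeg ▸ le_self_add
    rw [Set.encard_le_one_iff] at hone
    have hsub : G.ends (J \ {e}) ⊆ G.ends J \ {x} := by
      rintro y ⟨f, ⟨hf, hfe⟩, hy⟩
      refine ⟨⟨f, hf, hy⟩, ?_⟩
      rintro rfl
      exact hfe (hone f e (edgeInduce_inc.2 ⟨hf, hy⟩) (edgeInduce_inc.2 ⟨he, hex⟩))
    have h1 := hmin (J \ {e}) (Set.sdiff_singleton_ssubset.2 he)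
    have h2 := Set.ncard_le_ncard hsub hfin.sdiff
    have h3 := Set.ncard_sdiff_singleton_add_one he hJ
    have h4 := Set.ncard_sdiff_singleton_add_one hx hfin
    omega
  · intro c hc
    set U : Set α := Subtype.val '' c.supp with hUdef
    set K : Set β := {e ∈ J | ∃ x ∈ U, G.Inc e x} with hKdef
    have hUsub : U ⊆ G.ends J := by
      rintro _ ⟨x, -, rfl⟩
      exact x.2
    have hclosed : ∀ e ∈ J, ∀ x y, G.IsLink e x y → x ∈ U → y ∈ U := by
      rintro e he x y hxy ⟨x', hx', rfl⟩
      have hl : (G.edgeInduce J).IsLink e x' y := edgeInduce_isLink.2 ⟨he, hxy⟩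
      refine ⟨⟨y, hl.right_mem⟩, ?_, rfl⟩
      by_cases hxy' : x' = ⟨y, hl.right_mem⟩
      · rwa [← hxy']
      · have hadj : (G.edgeInduce J).toSimpleGraph.Adj x' ⟨y, hl.right_mem⟩ :=
          ⟨hxy', ⟨e, hl⟩⟩
        rw [SimpleGraph.ConnectedComponent.mem_supp_iff] at hx' ⊢
        rw [← hx']
        exact (SimpleGraph.ConnectedComponent.sound hadj.reachable).symm
    have hKfin : K.Finite := hJ.subset fun e he ↦ he.1
    have hle : K.ncard ≤ U.ncard := by
      refine ncard_le_of_deg_eq_two (G.edgeInduce J) hKfin (hfin.subset hUsub) ?_ ?_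
      · rintro _ ⟨x, hx, rfl⟩
        exact hc x hx
      · rintro e ⟨he, x, hx, y, hxy⟩
        exact ⟨x, hx, y, hclosed e he x y hxy hx, edgeInduce_isLink.2 ⟨he, hxy⟩⟩
    have hKne : K.Nonempty := by
      obtain ⟨x, hx⟩ := c.nonempty_supp
      obtain ⟨e, he, hex⟩ := x.2
      exact ⟨e, he, x, ⟨x, hx, rfl⟩, hex⟩
    have hss : J \ K ⊂ J := by
      refine ⟨Set.sdiff_subset, fun h ↦ ?_⟩
      obtain ⟨e, he⟩ := hKne
      exact (h he.1).2 he
    have hsub : G.ends (J \ K) ⊆ G.ends J \ U := by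
      rintro y ⟨f, ⟨hf, hfK⟩, hy⟩
      exact ⟨⟨f, hf, hy⟩, fun hyU ↦ hfK ⟨hf, y, hyU, hy⟩⟩
    have h1 := hmin _ hss
    have h2 := Set.ncard_le_ncard hsub hfin.sdiff
    have h3 := Set.ncard_sdiff_add_ncard_of_subset (fun e (he : e ∈ K) ↦ he.1) hJ
    have h4 := Set.ncard_sdiff_add_ncard_of_subset hUsub hfin
    omega

/-- An edge set contains no member of `C_1(G)` if and only if each of its finite subsets has at
most as many edges as ends. -/
lemma forall_circularSets_not_subset_iff {α β : Type*} (G : Graph α β) {I : Set β}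
    (hI : I ⊆ E(G)) :
    (∀ C ∈ G.circularSets 1, ¬ C ⊆ I) ↔ ∀ J ⊆ I, J.Finite → J.ncard ≤ (G.ends J).ncard := by
  constructor
  · intro h J hJI hJ
    by_contra! hlt
    obtain ⟨L, hLJ, hL⟩ := (hJ.finite_subsets.subset (fun L (hL : L ∈
      {L : Set β | L ⊆ J ∧ (G.ends L).ncard < L.ncard}) ↦ hL.1)).exists_le_minimal
        (show J ∈ {L : Set β | L ⊆ J ∧ (G.ends L).ncard < L.ncard} from ⟨subset_rfl, hlt⟩)
    refine h L (G.mem_circularSets_of_minimal ((hLJ.trans hJI).trans hI) (hJ.subset hLJ)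
      hL.prop.2 fun M hM ↦ ?_) (hLJ.trans hJI)
    by_contra! hlt'
    exact hM.2 (hL.2 ⟨hM.1.trans hLJ, hlt'⟩ hM.1)
  · rintro h C ⟨hCE, hCfin, hex, -⟩ hCI
    have := h C hCI hCfin
    rw [excess, edgeSet_edgeInduce hCE, vertexSet_edgeInduce] at hex
    omega

/-- The augmentation property. -/
lemma exists_augment {α β : Type*} (G : Graph α β) {I J : Set β} (hIfin : I.Finite)
    (hJfin : J.Finite) (hI : ∀ L ⊆ I, L.Finite → L.ncard ≤ (G.ends L).ncard)
    (hJ : ∀ L ⊆ J, L.Finite → L.ncard ≤ (G.ends L).ncard) (hlt : I.ncard < J.ncard) :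
    ∃ e ∈ J, e ∉ I ∧ ∀ L ⊆ insert e I, L.Finite → L.ncard ≤ (G.ends L).ncard := by
  by_contra! hcon
  -- take a maximal tight subset `T` of `I`
  obtain ⟨T, -, hT⟩ := (hIfin.finite_subsets.subset (fun L (hL : L ∈
      {L : Set β | L ⊆ I ∧ (G.ends L).ncard = L.ncard}) ↦ hL.1)).exists_le_maximal
        (show ∅ ∈ {L : Set β | L ⊆ I ∧ (G.ends L).ncard = L.ncard} by simp [ends])
  obtain ⟨⟨hTI, hTt⟩, hTmax⟩ := hT
  have hTfin := hIfin.subset hTI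
  have hall : ∀ e ∈ J \ I, G.ends {e} ⊆ G.ends T := by
    rintro e ⟨heJ, heI⟩
    obtain ⟨L, hL, hLfin, hLlt⟩ := hcon e heJ heI
    have heL : e ∈ L := by
      by_contra heL
      have := hI L (fun f hf ↦ (hL hf).resolve_left (by rintro rfl; exact heL hf)) hLfin
      omega
    have hSI : L \ {e} ⊆ I := fun f hf ↦ (hL hf.1).resolve_left hf.2
    have hS := hI _ hSI hLfin.sdiff
    have hc := Set.ncard_sdiff_singleton_add_one heL hLfin
    have hmono := G.ends_mono (Set.sdiff_subset (s := L) (t := {e}))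
    have hm := Set.ncard_le_ncard hmono (G.ends_finite hLfin)
    have heq : G.ends (L \ {e}) = G.ends L :=
      Set.eq_of_subset_of_ncard_le hmono (by omega) (G.ends_finite hLfin)
    -- the union of the tight sets is tight
    set S := L \ {e} with hSdef
    have hSfin : S.Finite := hLfin.sdiff
    have hST : S ∪ T ∈ {L : Set β | L ⊆ I ∧ (G.ends L).ncard = L.ncard} := by
      refine ⟨Set.union_subset hSI hTI, ?_⟩
      have h1 := Set.ncard_union_add_ncard_inter S T hSfin hTfin
      have h2 := Set.ncard_union_add_ncard_inter (G.ends S) (G.ends T)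
        (G.ends_finite hSfin) (G.ends_finite hTfin)
      have h3 := hI (S ∩ T) (Set.inter_subset_left.trans hSI) (hSfin.inter_of_left _)
      have h4 := Set.ncard_le_ncard (Set.subset_inter
        (G.ends_mono (Set.inter_subset_left (s := S) (t := T)))
        (G.ends_mono (Set.inter_subset_right (s := S) (t := T))))
        ((G.ends_finite hSfin).inter_of_left _)
      have h5 := hI (S ∪ T) (Set.union_subset hSI hTI) (hSfin.union hTfin)
      rw [← ends_union] at h2
      rw [heq] at h2 h4 hS hm
      omega
    have hSsub : S ⊆ T := Set.subset_union_left.trans (hTmax hST Set.subset_union_right)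
    calc G.ends {e} ⊆ G.ends L := G.ends_mono (by simpa using heL)
      _ = G.ends S := heq.symm
      _ ⊆ G.ends T := G.ends_mono hSsub
  have hsub : G.ends ((J \ I) ∪ (J ∩ T)) ⊆ G.ends T := by
    rintro x ⟨f, hf | hf, hx⟩
    · exact hall f hf ⟨f, rfl, hx⟩
    · exact ⟨f, hf.2, hx⟩
  have h1 := hJ ((J \ I) ∪ (J ∩ T)) (Set.union_subset Set.sdiff_subset Set.inter_subset_left)
    (hJfin.subset (Set.union_subset Set.sdiff_subset Set.inter_subset_left))
  have h2 := Set.ncard_le_ncard hsub (G.ends_finite hTfin)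
  have h3 : ((J \ I) ∪ (J ∩ T)).ncard = (J \ I).ncard + (J ∩ T).ncard :=
    Set.ncard_union_eq (Set.disjoint_left.2 fun f hf hf' ↦ hf.2 (hTI hf'.2))
      hJfin.sdiff (hJfin.inter_of_left _)
  have h4 := Set.ncard_inter_add_ncard_sdiff_eq_ncard J I hJfin
  have h5 := Set.ncard_inter_add_ncard_sdiff_eq_ncard I T hIfin
  have h6 : (J ∩ I).ncard ≤ (J ∩ T).ncard + (I \ T).ncard := by
    refine (Set.ncard_le_ncard (t := (J ∩ T) ∪ (I \ T)) ?_
      ((hJfin.inter_of_left _).union hIfin.sdiff)).trans (Set.ncard_union_le _ _)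
    rintro f ⟨hfJ, hfI⟩
    by_cases hfT : f ∈ T
    · exact Or.inl ⟨hfJ, hfT⟩
    · exact Or.inr ⟨hfI, hfT⟩
  rw [Set.inter_eq_self_of_subset_right hTI] at h5
  omega

/-- The bicircular matroid `M_1(G)`, the matroid on `E(G)` with set of circuits `C_1(G)`: a set of
edges is independent if and only if it contains no member of `C_1(G)`. -/
noncomputable def bicircularMatroid {α β : Type*} (G : Graph α β) : Matroid β :=
  (IndepMatroid.ofFinitaryCardAugment
    (E := E(G))
    (Indep := fun I ↦ I ⊆ E(G) ∧ ∀ C ∈ G.circularSets 1, ¬ C ⊆ I)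
    (indep_empty := ⟨Set.empty_subset _,
      (G.forall_circularSets_not_subset_iff (Set.empty_subset _)).2 fun J hJ _ ↦ by
        simp [Set.subset_empty_iff.1 hJ]⟩)
    (indep_subset := fun _ _ hJ hIJ ↦
      ⟨hIJ.trans hJ.1, fun C hC hCI ↦ hJ.2 C hC (hCI.trans hIJ)⟩)
    (indep_aug := by
      rintro I J ⟨hIE, hI⟩ hIfin ⟨hJE, hJ⟩ hJfin hlt
      obtain ⟨e, heJ, heI, he⟩ := G.exists_augment hIfin hJfin
        ((G.forall_circularSets_not_subset_iff hIE).1 hI)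
        ((G.forall_circularSets_not_subset_iff hJE).1 hJ) hlt
      have hE : insert e I ⊆ E(G) := Set.insert_subset (hJE heJ) hIE
      exact ⟨e, heJ, heI, hE, (G.forall_circularSets_not_subset_iff hE).2 he⟩)
    (indep_compact := by
      refine fun I h ↦ ⟨fun e he ↦ ?_, fun C hC hCI ↦ (h C hCI hC.2.1).2 C hC subset_rfl⟩
      exact (h {e} (by simpa using he) (Set.finite_singleton e)).1 rfl)
    (subset_ground := fun _ h ↦ h.1)).matroid

lemma bicircularMatroid_indep_iff {α β : Type*} (G : Graph α β) {I : Set β} :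
    G.bicircularMatroid.Indep I ↔ I ⊆ E(G) ∧ ∀ C ∈ G.circularSets 1, ¬ C ⊆ I := Iff.rfl

@[simp] lemma bicircularMatroid_ground {α β : Type*} (G : Graph α β) :
    G.bicircularMatroid.E = E(G) := rfl

/-- No member of `C_1(G)` properly contains another one. -/
lemma circularSets_antichain {α β : Type*} (G : Graph α β) {C D : Set β}
    (hC : C ∈ G.circularSets 1) (hD : D ∈ G.circularSets 1) (hDC : D ⊆ C) : C ⊆ D := by
  classical
  obtain ⟨hCE, hCfin, hCex, hCc⟩ := hC
  obtain ⟨hDE, hDfin, hDex, -⟩ := hD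
  rw [excess, edgeSet_edgeInduce hCE, vertexSet_edgeInduce] at hCex
  rw [excess, edgeSet_edgeInduce hDE, vertexSet_edgeInduce] at hDex
  by_contra hne
  set H := G.edgeInduce C with hH
  have hcard : (C \ D).ncard = (G.ends C \ G.ends D).ncard := by
    have h1 := Set.ncard_sdiff_add_ncard_of_subset hDC hCfin
    have h2 := Set.ncard_sdiff_add_ncard_of_subset (G.ends_mono hDC) (G.ends_finite hCfin)
    omega
  obtain ⟨U, hU⟩ := ((G.ends_finite hCfin).sdiff (t := G.ends D)).exists_finset_coe
  obtain ⟨K, hK⟩ := (hCfin.sdiff (t := D)).exists_finset_coe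
  rw [← hU, ← hK, Set.ncard_coe_finset, Set.ncard_coe_finset] at hcard
  have hUK : ∀ x ∈ U, ∀ e, H.Inc e x → e ∈ K := by
    intro x hx e he
    rw [← Finset.mem_coe, hU] at hx
    rw [edgeInduce_inc] at he
    rw [← Finset.mem_coe, hK]
    exact ⟨he.1, fun heD ↦ hx.2 ⟨e, heD, he.2⟩⟩
  let w : β → α → ℕ := fun e x ↦
    (if H.Inc e x then 1 else 0) + (if H.IsLoopAt e x then 1 else 0)
  have hdeg : ∀ x ∈ U, H.deg x = (∑ e ∈ K, w e x : ℕ) := by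
    intro x hx
    have ha : H.incidenceSet x = (K.filter fun e ↦ H.Inc e x : Finset β) := by
      ext e
      simpa using hUK x hx e
    have hb : H.loopSet x = (K.filter fun e ↦ H.IsLoopAt e x : Finset β) := by
      ext e
      simpa using fun h : H.IsLoopAt e x ↦ hUK x hx e h.inc
    rw [deg, ha, hb, Set.encard_coe_eq_coe_finsetCard, Set.encard_coe_eq_coe_finsetCard,
      Finset.sum_add_distrib, ← Finset.card_filter, ← Finset.card_filter]
    push_cast
    rfl
  have hdeg2 : ∀ x ∈ U, 2 ≤ ∑ e ∈ K, w e x := by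
    intro x hx
    have hxV : x ∈ V(H) := by
      rw [← Finset.mem_coe, hU] at hx
      exact hx.1
    have h1 := hCc.noLeaf x hxV
    rw [hdeg x hx] at h1
    obtain ⟨e, he⟩ := hCc.noIsolated x hxV
    have h0 : w e x ≤ ∑ e ∈ K, w e x :=
      Finset.single_le_sum (f := fun e ↦ w e x) (fun _ _ ↦ Nat.zero_le _) (hUK x hx e he)
    have h2 : 1 ≤ w e x := by
      have : H.Inc e x := he
      simp [w, this]
    have h3 : ∑ e ∈ K, w e x ≠ 1 := by exact_mod_cast h1
    omega
  have hw : ∀ e ∈ K, ∑ x ∈ U, w e x ≤ 2 ∧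
      ((∃ x y, H.IsLink e x y ∧ x ∈ U ∧ y ∉ U) → ∑ x ∈ U, w e x ≤ 1) := by
    intro e he
    have aux : ∀ x y, H.IsLink e x y → ∑ z ∈ U, w e z ≤ 2 ∧ (y ∉ U → ∑ z ∈ U, w e z ≤ 1) := by
      intro x y hxy
      have hInc : (U.filter fun z ↦ H.Inc e z) ⊆ U.filter fun z ↦ z = x ∨ z = y := by
        intro z hz
        rw [Finset.mem_filter] at hz ⊢
        exact ⟨hz.1, hz.2.eq_or_eq_of_isLink hxy⟩
      have hsum : ∑ z ∈ U, w e z =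
          (U.filter fun z ↦ H.Inc e z).card + (U.filter fun z ↦ H.IsLoopAt e z).card := by
        rw [Finset.sum_add_distrib, ← Finset.card_filter, ← Finset.card_filter]
      by_cases hxy' : x = y
      · subst hxy'
        have hi : ∀ z ∈ U.filter fun z ↦ H.Inc e z, z = x ∧ z ∈ U := fun z hz ↦ by
          have := Finset.mem_filter.1 (hInc hz)
          grind
        have hl : (U.filter fun z ↦ H.IsLoopAt e z) ⊆ U.filter fun z ↦ H.Inc e z :=
          Finset.monotone_filter_right _ fun z _ hz ↦ hz.inc
        have c1 : (U.filter fun z ↦ H.Inc e z).card ≤ 1 :=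
          Finset.card_le_one.2 fun a ha b hb ↦ (hi a ha).1.trans (hi b hb).1.symm
        have c2 := Finset.card_le_card hl
        refine ⟨by omega, fun hx ↦ ?_⟩
        have c3 : (U.filter fun z ↦ H.Inc e z) = ∅ :=
          Finset.eq_empty_of_forall_notMem fun z hz ↦ hx ((hi z hz).1 ▸ (hi z hz).2)
        rw [c3, Finset.card_empty] at c2 hsum
        omega
      · have hl : (U.filter fun z ↦ H.IsLoopAt e z) = ∅ := by
          refine Finset.filter_eq_empty_iff.2 fun z _ hz ↦ hxy' ?_
          have h1 := hxy.inc_left.eq_or_eq_of_isLink hz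
          have h2 := hxy.inc_right.eq_or_eq_of_isLink hz
          grind
        rw [hl, Finset.card_empty, add_zero] at hsum
        constructor
        · rw [hsum]
          refine (Finset.card_le_card (t := {x, y}) fun z hz ↦ ?_).trans Finset.card_le_two
          have := (Finset.mem_filter.1 (hInc hz)).2
          simpa using this
        · intro hy
          rw [hsum]
          refine (Finset.card_le_card (t := {x}) fun z hz ↦ ?_).trans (by simp)
          have := Finset.mem_filter.1 (hInc hz)
          grind
    have heE : e ∈ E(H) := by
      rw [edgeSet_edgeInduce hCE]
      rw [← Finset.mem_coe, hK] at he
      exact he.1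
    obtain ⟨x, y, hxy⟩ := H.exists_isLink_of_mem_edgeSet heE
    exact ⟨(aux x y hxy).1, fun ⟨a, b, hab, _, hb⟩ ↦ (aux a b hab).2 hb⟩
  have hsumU : ∑ x ∈ U, ∑ e ∈ K, w e x = ∑ x ∈ U, 2 := by
    refine le_antisymm ?_ (Finset.sum_le_sum hdeg2)
    rw [Finset.sum_comm]
    refine (Finset.sum_le_sum fun e he ↦ (hw e he).1).trans ?_
    simp [hcard]
  have hsumK : ∑ e ∈ K, ∑ x ∈ U, w e x = ∑ e ∈ K, 2 := by
    rw [Finset.sum_comm, hsumU]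
    simp [hcard]
  have htwo := (Finset.sum_eq_sum_iff_of_le hdeg2).1 hsumU.symm
  have hboth := (Finset.sum_eq_sum_iff_of_le fun e he ↦ (hw e he).1).1 hsumK
  have hclosed : ∀ x y, H.Adj x y → x ∈ U → y ∈ U := by
    rintro x y ⟨e, hxy⟩ hx
    by_contra hy
    have heK := hUK x hx e hxy.inc_left
    have := (hw e heK).2 ⟨x, y, hxy, hx, hy⟩
    have := hboth e heK
    omega
  have hUne : U.Nonempty := by
    obtain ⟨e, heC, heD⟩ := Set.not_subset.1 hne
    have : e ∈ K := by
      rw [← Finset.mem_coe, hK]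
      exact ⟨heC, heD⟩
    exact Finset.card_pos.1 (hcard ▸ Finset.card_pos.2 ⟨e, this⟩)
  obtain ⟨x, hx⟩ := hUne
  have hxV : x ∈ V(H) := by
    rw [← Finset.mem_coe, hU] at hx
    exact hx.1
  refine hCc.noCycleComponent (H.toSimpleGraph.connectedComponentMk ⟨x, hxV⟩) fun y hy ↦ ?_
  have hreach : H.toSimpleGraph.Reachable ⟨x, hxV⟩ y :=
    (SimpleGraph.ConnectedComponent.exact hy).symm
  have hyU : (y : α) ∈ U := by
    obtain ⟨p⟩ := hreach
    have key : ∀ (a b : V(H)), H.toSimpleGraph.Walk a b → (a : α) ∈ U → (b : α) ∈ U := by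
      intro a b p
      induction p with
      | nil => exact id
      | cons h _ ih => exact fun ha ↦ ih (hclosed _ _ h.2 ha)
    exact key _ _ p hx
  rw [hdeg y hyU, ← htwo y hyU]
  rfl

/-- The circuits of `M_1(G)` are exactly the members of `C_1(G)`. -/
theorem bicircularMatroid_isCircuit_iff {α β : Type*} (G : Graph α β) {C : Set β} :
    G.bicircularMatroid.IsCircuit C ↔ C ∈ G.circularSets 1 := by
  have hdep : ∀ D ∈ G.circularSets 1, G.bicircularMatroid.Dep D := fun D hD ↦
    ⟨fun h ↦ (G.bicircularMatroid_indep_iff.1 h).2 D hD subset_rfl, hD.1⟩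
  have hone : ∀ D, G.bicircularMatroid.IsCircuit D → D ∈ G.circularSets 1 := by
    intro D hD
    have hnot : ¬ (D ⊆ E(G) ∧ ∀ F ∈ G.circularSets 1, ¬ F ⊆ D) := hD.not_indep
    push Not at hnot
    obtain ⟨F, hF, hFD⟩ := hnot hD.subset_ground
    rwa [← hD.eq_of_dep_subset (hdep F hF) hFD]
  refine ⟨hone C, fun hC ↦ ?_⟩
  obtain ⟨D, hDC, hD⟩ := (hdep C hC).exists_isCircuit_subset
  rwa [(G.circularSets_antichain hC (hone D hD) hDC).antisymm hDC]

/-- `G` is `n`-connected: it has more than `n` vertices and remains connected after the deletion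
of fewer than `n` vertices. -/
def IsVertexConnected {α β : Type*} (G : Graph α β) (n : ℕ) : Prop :=
  (n : ℕ∞) < V(G).encard ∧
    ∀ X ⊆ V(G), X.encard < n → (G.deleteVerts X).toSimpleGraph.Connected

/-- Isomorphism of multigraphs. -/
def Isomorphic {α β α' β' : Type*} (G : Graph α β) (G' : Graph α' β') : Prop :=
  ∃ (ν : V(G) ≃ V(G')) (ε : E(G) ≃ E(G')), ∀ (e : E(G)) (x y : V(G)),
    G.IsLink e x y ↔ G'.IsLink (ε e) (ν x) (ν y)

/-- Strong isomorphism of multigraphs with the same edge set: a bijection of the vertex sets that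
respects the ends of every edge. -/
def StronglyIsomorphic {α α' β : Type*} (G : Graph α β) (G' : Graph α' β) : Prop :=
  E(G) = E(G') ∧ ∃ ν : V(G) ≃ V(G'), ∀ (e : β) (x y : V(G)),
    G.IsLink e x y ↔ G'.IsLink e (ν x) (ν y)

end Graph

/-! Independence in the bicircular matroid means that no set of edges outnumbers its ends. The
matroid therefore counts ends wherever it has no coloops: a coloop-free set of rank `r` has exactly
`r` ends in every graph representing the matroid (`ncard_ends_eq_of_forall_exists_indep`). The proof
uses this to recover vertex stars.

Let `n` be the number of vertices of `G`, and call a vertex `v` good if at least `n` edges avoid it.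
If `v` is good, 3-connectedness and Hall's theorem show that the edges avoiding `v` have rank `n -
1` and no coloops, and that some basis of them extends independently by any edge at `v`
(`exists_indep_insert`). Taking all edges, the same argument gives `G'` exactly `n` vertices. The
edges avoiding `v` then miss exactly one vertex `v'` of `G'`. An edge at `v` must meet `v'`, since
otherwise `n` independent edges would have only `n - 1` ends. Hence `v` and `v'` have the same star
(`exists_incidenceSet_eq`).

For `n ≥ 5` a degree count leaves at most one vertex `h` that is not good, such as the hub of a
wheel (`exists_forall_ncard_le`). It is matched with the one vertex of `G'` left over, and its star
follows from the others. For `n = 4` no vertex is good, but the only such graph is `K₄`. -/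

namespace Graph

variable {α α' β : Type*}

/-! ### Independence, and the number of ends of a coloop-free set -/

/-- A set of edges is independent in the bicircular matroid iff each of its finite subsets has at
most as many edges as ends. -/
lemma bicircularMatroid_indep_iff_ncard_le (G : Graph α β) {I : Set β} :
    G.bicircularMatroid.Indep I ↔
      I ⊆ E(G) ∧ ∀ J ⊆ I, J.Finite → J.ncard ≤ (G.ends J).ncard := by
  rw [bicircularMatroid_indep_iff]
  exact and_congr_right fun hI ↦ G.forall_circularSets_not_subset_iff hI

/-- Edges that can be assigned distinct ends form an independent set. -/
lemma indep_range_of_injective (G : Graph α β) {ι : Type*} {m : ι → β} {a : ι → α}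
    (ha : a.Injective) (h : ∀ i, G.Inc (m i) (a i)) : G.bicircularMatroid.Indep (Set.range m) := by
  rw [bicircularMatroid_indep_iff_ncard_le]
  refine ⟨?_, fun J hJ hJfin ↦ ?_⟩
  · rintro _ ⟨i, rfl⟩
    exact (h i).edge_mem
  obtain rfl | ⟨e₀, he₀⟩ := J.eq_empty_or_nonempty
  · simp
  have : Nonempty ι := ⟨(hJ he₀).choose⟩
  -- `m` need not be injective: choosing one index for each edge of `J` already gives distinct ends.
  have hJ' : ∀ e ∈ J, ∃ i, m i = e := fun e he ↦ hJ he
  choose! g hg using hJ'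
  refine Set.ncard_le_ncard_of_injOn (fun e ↦ a (g e)) (fun e he ↦ ⟨e, he, ?_⟩) ?_
    (G.ends_finite hJfin)
  · have := h (g e)
    rwa [hg e he] at this
  · intro e he f hf hef
    rw [← hg e he, ← hg f hf, ha hef]

/-- If `X` has rank `r` and no coloops in the bicircular matroid, then `X` has exactly `r` ends. -/
lemma ncard_ends_eq_of_forall_exists_indep (G : Graph α β) {X I : Set β} {r : ℕ}
    (hX : X.Finite) (hXE : X ⊆ E(G)) (hIX : I ⊆ X) (hI : G.bicircularMatroid.Indep I)
    (hIr : I.ncard = r) (hmax : ∀ J ⊆ X, G.bicircularMatroid.Indep J → J.ncard ≤ r)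
    (hcol : ∀ e ∈ X, ∃ J ⊆ X \ {e}, G.bicircularMatroid.Indep J ∧ J.ncard = r) :
    (G.ends X).ncard = r := by
  have hIfin := hX.subset hIX
  have hI' := (G.bicircularMatroid_indep_iff_ncard_le.1 hI).2
  -- Call a set tight if it has as many edges as ends. It turns out that the basis `I` is itself
  -- tight, that is, `T = I`.
  obtain ⟨T, -, hT⟩ := (hIfin.finite_subsets.subset (fun L (hL : L ∈
      {L : Set β | L ⊆ I ∧ (G.ends L).ncard = L.ncard}) ↦ hL.1)).exists_le_maximal
        (show ∅ ∈ {L : Set β | L ⊆ I ∧ (G.ends L).ncard = L.ncard} by simp [ends])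
  obtain ⟨⟨hTI, hTt⟩, hTmax⟩ := hT
  have hTfin := hIfin.subset hTI
  have hall : ∀ e ∈ X \ I, G.ends {e} ⊆ G.ends T := by
    rintro e ⟨heX, heI⟩
    have hnot : ¬ G.bicircularMatroid.Indep (insert e I) := by
      intro h
      have h1 := hmax _ (Set.insert_subset heX hIX) h
      rw [Set.ncard_insert_of_notMem heI hIfin] at h1
      omega
    rw [bicircularMatroid_indep_iff_ncard_le] at hnot
    push Not at hnot
    obtain ⟨L, hL, hLfin, hLlt⟩ := hnot (Set.insert_subset (hXE heX) (hIX.trans hXE))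
    have heL : e ∈ L := by
      by_contra heL
      have := hI' L (fun f hf ↦ (hL hf).resolve_left (by rintro rfl; exact heL hf)) hLfin
      omega
    have hSI : L \ {e} ⊆ I := fun f hf ↦ (hL hf.1).resolve_left hf.2
    have hS := hI' _ hSI hLfin.sdiff
    have hc := Set.ncard_sdiff_singleton_add_one heL hLfin
    have hmono := G.ends_mono (Set.sdiff_subset (s := L) (t := {e}))
    -- Removing `e` from the violating set `L` leaves an independent set, so the counts are
    -- squeezed: `L \ {e}` is tight and already has both ends of `e`.
    have heq : G.ends (L \ {e}) = G.ends L :=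
      Set.eq_of_subset_of_ncard_le hmono (by omega) (G.ends_finite hLfin)
    set S := L \ {e} with hSdef
    have hSfin : S.Finite := hLfin.sdiff
    -- Counting ends is submodular, and `S ∩ T` has at least as many ends as edges, so tightness
    -- passes to the union. Maximality of `T` then absorbs `S`.
    have hST : S ∪ T ∈ {L : Set β | L ⊆ I ∧ (G.ends L).ncard = L.ncard} := by
      refine ⟨Set.union_subset hSI hTI, ?_⟩
      have h1 := Set.ncard_union_add_ncard_inter S T hSfin hTfin
      have h2 := Set.ncard_union_add_ncard_inter (G.ends S) (G.ends T)
        (G.ends_finite hSfin) (G.ends_finite hTfin)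
      have h3 := hI' (S ∩ T) (Set.inter_subset_left.trans hSI) (hSfin.inter_of_left _)
      have h4 := Set.ncard_le_ncard (Set.subset_inter
        (G.ends_mono (Set.inter_subset_left (s := S) (t := T)))
        (G.ends_mono (Set.inter_subset_right (s := S) (t := T))))
        ((G.ends_finite hSfin).inter_of_left _)
      have h5 := hI' (S ∪ T) (Set.union_subset hSI hTI) (hSfin.union hTfin)
      rw [← ends_union] at h2
      rw [heq] at h2 h4 hS
      omega
    calc G.ends {e} ⊆ G.ends L := G.ends_mono (by simpa using heL)
      _ = G.ends S := heq.symm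
      _ ⊆ G.ends T :=
        G.ends_mono (Set.subset_union_left.trans (hTmax hST Set.subset_union_right))
  -- Only here are coloops excluded. A basis `J` avoiding some `f ∈ I \ T` has fewer than `|I \ T|`
  -- edges in `I \ T`. Its other edges have all ends among those of `T`, so there are at most `|T|`
  -- of them, and `J` is too small.
  have hIT : I ⊆ T := by
    by_contra hne
    obtain ⟨f, hfI, hfT⟩ := Set.not_subset.1 hne
    obtain ⟨J, hJX, hJ, hJr⟩ := hcol f (hIX hfI)
    have hJfin : J.Finite := hX.subset (hJX.trans Set.sdiff_subset)
    have h1 := (G.bicircularMatroid_indep_iff_ncard_le.1 hJ).2 (J \ (I \ T)) Set.sdiff_subset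
      hJfin.sdiff
    have h2 : G.ends (J \ (I \ T)) ⊆ G.ends T := by
      rintro x ⟨e, ⟨heJ, heIT⟩, hx⟩
      by_cases heI : e ∈ I
      · exact ⟨e, by_contra fun heT ↦ heIT ⟨heI, heT⟩, hx⟩
      · exact hall e ⟨(hJX heJ).1, heI⟩ ⟨e, rfl, hx⟩
    have h3 := Set.ncard_le_ncard h2 (G.ends_finite hTfin)
    have h4 := Set.ncard_inter_add_ncard_sdiff_eq_ncard J (I \ T) hJfin
    have h5 : (J ∩ (I \ T)).ncard < (I \ T).ncard :=
      Set.ncard_lt_ncard ⟨Set.inter_subset_right, fun h ↦ (hJX (h ⟨hfI, hfT⟩).1).2 rfl⟩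
        hIfin.sdiff
    have h6 := Set.ncard_sdiff_add_ncard_of_subset hTI hIfin
    omega
  obtain rfl := hTI.antisymm hIT
  have : G.ends X = G.ends T := by
    refine Set.Subset.antisymm ?_ (G.ends_mono hIX)
    rintro x ⟨e, he, hx⟩
    by_cases heT : e ∈ T
    · exact ⟨e, heT, hx⟩
    · exact hall e ⟨he, heT⟩ ⟨e, rfl, hx⟩
  rw [this, hTt, hIr]

/-! ### Edge counts and degree sums -/

/-- A finite simple graph has finitely many edges. -/
lemma edgeSet_finite_of_simple (G : Graph α β) [G.Simple] (hV : V(G).Finite) : E(G).Finite := by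
  have : E(G) ⊆ ⋃ x ∈ V(G), ⋃ y ∈ V(G), {e | G.IsLink e x y} := by
    intro e he
    obtain ⟨x, y, hxy⟩ := G.exists_isLink_of_mem_edgeSet he
    simp only [Set.mem_iUnion]
    exact ⟨x, hxy.left_mem, y, hxy.right_mem, hxy⟩
  refine (hV.biUnion fun x _ ↦ hV.biUnion fun y _ ↦ ?_).subset this
  exact Set.Subsingleton.finite fun e he f hf ↦ IsLink.eq he hf

open Classical in
/-- Every edge has at most two ends in any set of vertices, and at most one end in it if it leaves
the set. -/
lemma card_filter_inc_le (G : Graph α β) (S : Finset α) (e : β) :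
    (S.filter fun x ↦ G.Inc e x).card ≤ 2 ∧
      ∀ x y, G.IsLink e x y → y ∉ S → (S.filter fun x ↦ G.Inc e x).card ≤ 1 := by
  constructor
  · by_cases he : e ∈ E(G)
    · obtain ⟨x, y, hxy⟩ := G.exists_isLink_of_mem_edgeSet he
      refine (Finset.card_le_card (t := {x, y}) fun z hz ↦ ?_).trans Finset.card_le_two
      simpa using (Finset.mem_filter.1 hz).2.eq_or_eq_of_isLink hxy
    · simp [he]
  · intro x y hxy hy
    refine (Finset.card_le_card (t := {x}) fun z hz ↦ ?_).trans (by simp)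
    have hz := Finset.mem_filter.1 hz
    have := hz.2.eq_or_eq_of_isLink hxy
    grind

open Classical in
/-- The sum over `S` of the numbers of edges of `F` at the vertices of `S` is at most twice the
number of edges of `F` meeting `S`, and smaller than that if an edge of `F` leaves `S`. -/
lemma sum_card_filter_inc_le (G : Graph α β) (S : Finset α) (F : Finset β) :
    ∑ x ∈ S, (F.filter fun e ↦ G.Inc e x).card ≤ 2 * (F.filter fun e ↦ ∃ x ∈ S, G.Inc e x).card ∧
    ((∃ e ∈ F, ∃ x ∈ S, ∃ y ∉ S, G.IsLink e x y) →
      ∑ x ∈ S, (F.filter fun e ↦ G.Inc e x).card <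
        2 * (F.filter fun e ↦ ∃ x ∈ S, G.Inc e x).card) := by
  set N := F.filter fun e ↦ ∃ x ∈ S, G.Inc e x with hN
  have h1 : ∑ x ∈ S, (F.filter fun e ↦ G.Inc e x).card =
      ∑ e ∈ N, (S.filter fun x ↦ G.Inc e x).card := by
    refine Eq.trans ?_
      (Finset.sum_card_bipartiteAbove_eq_sum_card_bipartiteBelow (fun x e ↦ G.Inc e x))
    refine Finset.sum_congr rfl fun x hx ↦ ?_
    congr 1
    ext e
    simp only [Finset.bipartiteAbove, hN, Finset.mem_filter]
    exact ⟨fun h ↦ ⟨⟨h.1, x, hx, h.2⟩, h.2⟩, fun h ↦ ⟨h.1.1, h.2⟩⟩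
  have h2 : 2 * N.card = ∑ e ∈ N, 2 := by simp [mul_comm]
  rw [h1, h2]
  refine ⟨Finset.sum_le_sum fun e _ ↦ (G.card_filter_inc_le S e).1, ?_⟩
  rintro ⟨e, he, x, hx, y, hy, hxy⟩
  refine Finset.sum_lt_sum (fun e _ ↦ (G.card_filter_inc_le S e).1)
    ⟨e, Finset.mem_filter.2 ⟨he, x, hx, hxy.inc_left⟩, ?_⟩
  have := (G.card_filter_inc_le S e).2 x y hxy hy
  omega

/-! ### Degrees and cuts in 3-connected graphs -/

lemma IsVertexConnected.three_lt_ncard {G : Graph α β} (hG : G.IsVertexConnected 3)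
    (hV : V(G).Finite) : 3 < V(G).ncard := by
  have := hG.1
  rw [← hV.cast_ncard_eq] at this
  exact_mod_cast this

/-- In a `3`-connected simple graph every vertex has degree at least three. -/
lemma IsVertexConnected.three_le_ncard_incidenceSet {G : Graph α β} [G.Simple]
    (hG : G.IsVertexConnected 3) (hV : V(G).Finite) {x : α} (hx : x ∈ V(G)) :
    3 ≤ (G.incidenceSet x).ncard := by
  by_contra! hlt
  have hEfin := G.edgeSet_finite_of_simple hV
  have hIfin : (G.incidenceSet x).Finite := hEfin.subset (G.incidenceSet_subset_edgeSet x)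
  set N : Set α := {y | G.Adj x y} with hN
  have hNV : N ⊆ V(G) := fun y hy ↦ hy.right_mem
  have hNfin := hV.subset hNV
  have hNle : N.ncard ≤ (G.incidenceSet x).ncard := by
    obtain hN0 | ⟨y₀, e₀, -⟩ := N.eq_empty_or_nonempty
    · simp [hN0]
    have : Nonempty β := ⟨e₀⟩
    have : ∀ y ∈ N, ∃ e, G.IsLink e x y := fun y hy ↦ hy
    choose! g hg using this
    refine Set.ncard_le_ncard_of_injOn g (fun y hy ↦ (hg y hy).inc_left) ?_ hIfin
    intro y hy z hz hyz
    exact (hg y hy).right_unique (hyz ▸ hg z hz)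
  -- With at most two neighbours, deleting them all would cut `x` off from a remaining vertex `z`.
  have hc := hG.2 N hNV (by
    rw [← hNfin.cast_ncard_eq]
    exact_mod_cast (by omega : N.ncard < 3))
  have h3 := hG.three_lt_ncard hV
  obtain ⟨z, hzV, hz⟩ : ∃ z ∈ V(G), z ∉ insert x N := by
    by_contra! h
    have h1 := Set.ncard_le_ncard h (hNfin.insert x)
    have h2 := Set.ncard_insert_le x N
    omega
  have hxN : x ∉ N := fun h ↦ G.not_adj_self x h
  let x' : V(G.deleteVerts N) := ⟨x, by simpa using ⟨hx, hxN⟩⟩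
  let z' : V(G.deleteVerts N) := ⟨z, by simpa using ⟨hzV, fun h ↦ hz (Or.inr h)⟩⟩
  obtain ⟨p⟩ := hc.preconnected x' z'
  obtain ⟨d, -, hd1, hd2⟩ := p.exists_boundary_dart {x'} rfl
    (fun h ↦ hz (Or.inl (congrArg Subtype.val h)))
  obtain ⟨-, e, he⟩ := d.adj
  rw [Set.mem_singleton_iff] at hd1
  rw [hd1] at he
  have := (G.deleteVerts_isLink N).1 he
  exact this.2.2 ⟨e, this.1⟩

/-- In a graph that remains connected after the deletion of the vertex `v`, every proper nonempty
set of vertices different from `v` is left by some edge that avoids `v`. -/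
lemma IsVertexConnected.exists_isLink_of_ssubset {G : Graph α β} (hG : G.IsVertexConnected 3)
    {v : α} (hv : v ∈ V(G)) {S : Set α} (hS : S ⊂ V(G) \ {v}) (hne : S.Nonempty) :
    ∃ e, ∃ x ∈ S, ∃ y ∉ S, y ≠ v ∧ G.IsLink e x y := by
  have hc := hG.2 {v} (by simpa using hv) (by simp)
  obtain ⟨x, hx⟩ := hne
  obtain ⟨z, hz, hzS⟩ := Set.exists_of_ssubset hS
  let x' : V(G.deleteVerts {v}) := ⟨x, by simpa using hS.1 hx⟩
  let z' : V(G.deleteVerts {v}) := ⟨z, by simpa using hz⟩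
  obtain ⟨p⟩ := hc.preconnected x' z'
  obtain ⟨d, -, hd1, hd2⟩ := p.exists_boundary_dart {w | (w : α) ∈ S} hx hzS
  obtain ⟨-, e, he⟩ := d.adj
  have := (G.deleteVerts_isLink {v}).1 he
  exact ⟨e, _, hd1, _, hd2, this.2.2, this.1⟩

/-! ### Large independent sets from Hall's theorem -/

/-- Hall's condition for assigning to the vertices in `S` distinct incident edges in `F`. -/
lemma exists_injective_inc_of_card_le (G : Graph α β) [DecidableRel G.Inc] (S : Finset α)
    (F : Finset β)
    (h : ∀ T ⊆ S, T.card ≤ (F.filter fun e ↦ ∃ x ∈ T, G.Inc e x).card) :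
    ∃ m : S → β, m.Injective ∧ ∀ x, m x ∈ F ∧ G.Inc (m x) x := by
  classical
  obtain ⟨m, hm, hmem⟩ := (Finset.all_card_le_biUnion_card_iff_exists_injective
    (fun x : S ↦ F.filter fun e ↦ G.Inc e x)).1 (fun T ↦ by
      have h1 := h (T.map (Function.Embedding.subtype _)) (fun x hx ↦ by
        obtain ⟨y, -, rfl⟩ := Finset.mem_map.1 hx
        exact y.2)
      rw [Finset.card_map] at h1
      refine h1.trans (Finset.card_le_card fun e he ↦ ?_)
      simp only [Finset.mem_filter, Finset.mem_map, Finset.mem_biUnion] at he ⊢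
      obtain ⟨heF, _, ⟨y, hy, rfl⟩, hex⟩ := he
      exact ⟨y, hy, heF, hex⟩)
  exact ⟨m, hm, fun x ↦ Finset.mem_filter.1 (hmem x)⟩

open Classical in
/-- After the deletion of a vertex of a `3`-connected graph every vertex keeps degree at least
two. -/
lemma IsVertexConnected.two_le_card_filter_inc {G : Graph α β} [G.Simple]
    (hG : G.IsVertexConnected 3) (hV : V(G).Finite) {v x : α} (hx : x ∈ V(G)) (hxv : x ≠ v)
    {F : Finset β} (hF : (F : Set β) = E(G) \ G.incidenceSet v) :
    2 ≤ (F.filter fun e ↦ G.Inc e x).card := by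
  have h3 := hG.three_le_ncard_incidenceSet hV hx
  have hEfin := G.edgeSet_finite_of_simple hV
  -- By simplicity `x` loses at most one of its three or more edges when `v` is deleted.
  have hle : (G.incidenceSet x ∩ G.incidenceSet v).ncard ≤ 1 := by
    rw [Set.ncard_le_one (hEfin.subset (Set.inter_subset_left.trans
      (G.incidenceSet_subset_edgeSet x)))]
    rintro e ⟨⟨y, hy⟩, hev⟩ f ⟨⟨z, hz⟩, hfv⟩
    obtain rfl := Inc.eq_of_isLink_of_ne_left hev hy hxv.symm
    obtain rfl := Inc.eq_of_isLink_of_ne_left hfv hz hxv.symm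
    exact hy.eq hz
  have h4 := Set.ncard_inter_add_ncard_sdiff_eq_ncard (G.incidenceSet x) (G.incidenceSet v)
    (hEfin.subset (G.incidenceSet_subset_edgeSet x))
  have h5 : G.incidenceSet x \ G.incidenceSet v = (F.filter fun e ↦ G.Inc e x : Finset β) := by
    ext e
    have : e ∈ F ↔ e ∈ E(G) \ G.incidenceSet v := by rw [← hF, Finset.mem_coe]
    simp only [Finset.coe_filter, this, Set.mem_sdiff, mem_incidenceSet, Set.mem_ofPred_eq]
    exact ⟨fun h ↦ ⟨⟨h.1.edge_mem, h.2⟩, h.1⟩, fun h ↦ ⟨h.2, h.1.2⟩⟩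
  rw [h5, Set.ncard_coe_finset] at h4
  omega

/-- A vertex-deleted `3`-connected graph has at least as many edges as vertices. -/
lemma IsVertexConnected.ncard_le_ncard_sdiff_incidenceSet {G : Graph α β} [G.Simple]
    (hG : G.IsVertexConnected 3) (hV : V(G).Finite) {v : α} (hv : v ∈ V(G)) :
    V(G).ncard ≤ (E(G) \ G.incidenceSet v).ncard + 1 := by
  classical
  obtain ⟨F, hF⟩ :=
    ((G.edgeSet_finite_of_simple hV).sdiff (t := G.incidenceSet v)).exists_finset_coe
  obtain ⟨S, hS⟩ := (hV.sdiff (t := {v})).exists_finset_coe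
  have h1 := (G.sum_card_filter_inc_le S F).1
  have h2 : ∑ x ∈ S, 2 ≤ ∑ x ∈ S, (F.filter fun e ↦ G.Inc e x).card := by
    refine Finset.sum_le_sum fun x hx ↦ ?_
    rw [← Finset.mem_coe, hS] at hx
    exact hG.two_le_card_filter_inc hV hx.1 hx.2 hF
  have h3 := Finset.card_filter_le F fun e ↦ ∃ x ∈ S, G.Inc e x
  have h4 := Set.ncard_sdiff_singleton_add_one hv hV
  rw [← hS, Set.ncard_coe_finset] at h4
  rw [← hF, Set.ncard_coe_finset, ← h4]
  simp only [Finset.sum_const, smul_eq_mul] at h2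
  omega

/-- If at most one edge is removed from a vertex-deleted `3`-connected graph and enough edges
remain, then these contain a set of `|V(G)| - 1` edges that stays independent when any edge at the
deleted vertex is added. -/
lemma IsVertexConnected.exists_indep_insert {G : Graph α β} [G.Simple]
    (hG : G.IsVertexConnected 3) (hV : V(G).Finite) {v : α} (hv : v ∈ V(G)) {D : Set β}
    (hD : D.Subsingleton) (hcard : V(G).ncard ≤ ((E(G) \ G.incidenceSet v) \ D).ncard + 1) :
    ∃ I ⊆ (E(G) \ G.incidenceSet v) \ D, I.ncard + 1 = V(G).ncard ∧
      ∀ f, G.Inc f v → G.bicircularMatroid.Indep (insert f I) := by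
  classical
  obtain ⟨F, hF⟩ :=
    ((G.edgeSet_finite_of_simple hV).sdiff (t := G.incidenceSet v)).exists_finset_coe
  obtain ⟨S, hS⟩ := (hV.sdiff (t := {v})).exists_finset_coe
  have hSc : S.card + 1 = V(G).ncard := by
    rw [← Set.ncard_sdiff_singleton_add_one hv hV, ← hS, Set.ncard_coe_finset]
  have hFD : (E(G) \ G.incidenceSet v) \ D = (F.filter fun e ↦ e ∉ D : Finset β) := by
    ext e
    simp [← hF]
  have hFmem : ∀ e, e ∈ F ↔ e ∈ E(G) ∧ ¬ G.Inc e v := by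
    intro e
    rw [← Finset.mem_coe, hF]
    rfl
  have hSmem : ∀ x, x ∈ S ↔ x ∈ V(G) ∧ x ≠ v := by
    intro x
    rw [← Finset.mem_coe, hS]
    rfl
  rw [hFD, Set.ncard_coe_finset] at hcard
  obtain ⟨m, hm, hmF⟩ := G.exists_injective_inc_of_card_le S (F.filter fun e ↦ e ∉ D) (by
    intro T hTS
    obtain rfl | hne := T.eq_empty_or_nonempty
    · simp
    -- For all of `S`, Hall's condition is the assumed edge count. For a proper nonempty `T`,
    -- degrees at least two and an edge leaving `T` give more than `|T|` edges, so losing the single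
    -- possible edge of `D` does no harm.
    obtain rfl | hTS' := hTS.eq_or_ssubset
    · have : (F.filter fun e ↦ e ∉ D).filter (fun e ↦ ∃ x ∈ T, G.Inc e x) =
          F.filter fun e ↦ e ∉ D := by
        refine Finset.filter_true_of_mem fun e he ↦ ?_
        have he' := (hFmem e).1 (Finset.mem_filter.1 he).1
        obtain ⟨x, y, hxy⟩ := G.exists_isLink_of_mem_edgeSet he'.1
        exact ⟨x, (hSmem x).2 ⟨hxy.left_mem, by rintro rfl; exact he'.2 hxy.inc_left⟩,
          hxy.inc_left⟩
      rw [this]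
      omega
    · obtain ⟨e, x, hx, y, hy, hyv, hxy⟩ := hG.exists_isLink_of_ssubset hv (S := T)
        (by rw [← hS]; exact_mod_cast hTS') (by simpa using hne)
      have hxv := ((hSmem x).1 (hTS hx)).2
      have heF : e ∈ F := (hFmem e).2 ⟨hxy.edge_mem, fun h ↦ by
        obtain h | h := h.eq_or_eq_of_isLink hxy
        · exact hxv h.symm
        · exact hyv h.symm⟩
      have h1 := (G.sum_card_filter_inc_le T F).2 ⟨e, heF, x, hx, y, hy, hxy⟩
      have h2 : ∑ x ∈ T, 2 ≤ ∑ x ∈ T, (F.filter fun e ↦ G.Inc e x).card := by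
        refine Finset.sum_le_sum fun x hx ↦ ?_
        have := (hSmem x).1 (hTS hx)
        exact hG.two_le_card_filter_inc hV this.1 this.2 hF
      simp only [Finset.sum_const, smul_eq_mul] at h2
      have h3 : ((F.filter fun e ↦ ∃ x ∈ T, G.Inc e x).filter fun e ↦ ¬ e ∉ D).card ≤ 1 :=
        Finset.card_le_one.2 fun a ha b hb ↦ hD
          (not_not.1 (Finset.mem_filter.1 ha).2) (not_not.1 (Finset.mem_filter.1 hb).2)
      have h4 := Finset.card_filter_add_card_filter_not
        (s := F.filter fun e ↦ ∃ x ∈ T, G.Inc e x) (fun e ↦ e ∉ D)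
      rw [Finset.filter_comm]
      omega)
  refine ⟨Set.range m, ?_, ?_, fun f hf ↦ ?_⟩
  · rintro _ ⟨x, rfl⟩
    rw [hFD]
    exact (hmF x).1
  · rw [← hSc, ← Set.image_univ, Set.ncard_image_of_injective _ hm, Set.ncard_univ]
    simp
  -- The index `none` stands for `v`, which the matching leaves free to receive `f`.
  · have h1 := G.indep_range_of_injective (m := fun o : Option S ↦ o.elim f m)
      (a := fun o ↦ o.elim v (↑)) (by
        rintro (_ | x) (_ | y) hxy
        · rfl
        · exact absurd hxy.symm ((hSmem y).1 y.2).2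
        · exact absurd hxy ((hSmem x).1 x.2).2
        · exact congrArg some (Subtype.ext hxy)) (by
        rintro (_ | x)
        · exact hf
        · exact (hmF x).2)
    convert h1 using 1
    ext e
    simp [Option.exists, eq_comm]

/-! ### At most one exceptional vertex -/

/-- In a `3`-connected graph with at least five vertices at most one vertex-deleted subgraph has
as few edges as vertices. -/
lemma IsVertexConnected.exists_forall_ncard_le {G : Graph α β} [G.Simple]
    (hG : G.IsVertexConnected 3) (hV : V(G).Finite) (h5 : 5 ≤ V(G).ncard) :
    ∃ h ∈ V(G), ∀ v ∈ V(G), v ≠ h → V(G).ncard ≤ (E(G) \ G.incidenceSet v).ncard := by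
  classical
  have hEfin := G.edgeSet_finite_of_simple hV
  by_contra! hcon
  obtain ⟨a, ha⟩ : V(G).Nonempty := by
    rw [← Set.ncard_pos hV]
    omega
  -- Applying the negated claim at `a` and then at `h` gives two distinct vertices that are not
  -- good.
  obtain ⟨h, hh, -, hlt⟩ := hcon a ha
  obtain ⟨u, hu, huh, hlt'⟩ := hcon h hh
  obtain ⟨F, hF⟩ := hEfin.exists_finset_coe
  obtain ⟨S, hS⟩ := hV.exists_finset_coe
  have hSc : V(G).ncard = S.card := by rw [← hS, Set.ncard_coe_finset]
  have hdeg : ∀ x, (G.incidenceSet x).ncard = (F.filter fun e ↦ G.Inc e x).card := by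
    intro x
    rw [← Set.ncard_coe_finset]
    congr 1
    ext e
    have : e ∈ F ↔ e ∈ E(G) := by rw [← hF, Finset.mem_coe]
    simpa [this] using fun h : G.Inc e x ↦ h.edge_mem
  have hsub : ∀ x, (E(G) \ G.incidenceSet x).ncard + (G.incidenceSet x).ncard = F.card := by
    intro x
    rw [Set.ncard_sdiff_add_ncard_of_subset (G.incidenceSet_subset_edgeSet x) hEfin, ← hF,
      Set.ncard_coe_finset]
  have h1 := (G.sum_card_filter_inc_le S F).1
  have h2 := Finset.card_filter_le F fun e ↦ ∃ x ∈ S, G.Inc e x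
  have hhS : h ∈ S := by rwa [← Finset.mem_coe, hS]
  have huS : u ∈ S.erase h := Finset.mem_erase.2 ⟨huh, by rwa [← Finset.mem_coe, hS]⟩
  rw [← Finset.add_sum_erase S _ hhS, ← Finset.add_sum_erase _ _ huS, ← hdeg, ← hdeg] at h1
  -- Both `h` and `u` have degree at least `|E| - n + 1`, all others at least `3`. Then `2|E| ≥
  -- 2(|E| - n + 1) + 3(n - 2)`, which forces `n ≤ 4`.
  have h3 : ∑ x ∈ (S.erase h).erase u, 3 ≤
      ∑ x ∈ (S.erase h).erase u, (F.filter fun e ↦ G.Inc e x).card := by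
    refine Finset.sum_le_sum fun x hx ↦ ?_
    rw [← hdeg]
    refine hG.three_le_ncard_incidenceSet hV ?_
    rw [← hS]
    exact Finset.mem_of_mem_erase (Finset.mem_of_mem_erase hx)
  have h4 := Finset.card_erase_add_one hhS
  have h4' := Finset.card_erase_add_one huS
  simp only [Finset.sum_const, smul_eq_mul] at h3
  have := hsub h
  have := hsub u
  omega

/-! ### Recovering the vertices and their stars -/

/-- An independent subset of `X` has at most as many elements as `X` has ends. -/
lemma ncard_le_of_indep_of_ends_subset {G : Graph α β} {I X : Set β} {U : Set α}
    (hI : G.bicircularMatroid.Indep I) (hX : X.Finite) (hU : U.Finite) (hIX : I ⊆ X)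
    (hXU : G.ends X ⊆ U) : I.ncard ≤ U.ncard :=
  ((G.bicircularMatroid_indep_iff_ncard_le.1 hI).2 I subset_rfl (hX.subset hIX)).trans
    (Set.ncard_le_ncard ((G.ends_mono hIX).trans hXU) hU)

/-- A graph without isolated vertices whose bicircular matroid is that of a `3`-connected graph
`G` with at least five vertices has as many vertices as `G`. -/
lemma IsVertexConnected.ncard_vertexSet_eq {G : Graph α β} [G.Simple]
    (hG : G.IsVertexConnected 3) (hV : V(G).Finite) (h5 : 5 ≤ V(G).ncard) {G' : Graph α' β}
    (hiso : G'.NoIsolated) (hM : G.bicircularMatroid = G'.bicircularMatroid) :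
    V(G').Finite ∧ V(G').ncard = V(G).ncard := by
  have hE : E(G) = E(G') := congrArg Matroid.E hM
  have hEfin := G.edgeSet_finite_of_simple hV
  have hends : G'.ends E(G) = V(G') := by
    ext x
    refine ⟨fun ⟨e, _, hx⟩ ↦ hx.vertex_mem, fun hx ↦ ?_⟩
    obtain ⟨e, he⟩ := hiso x hx
    exact ⟨e, hE ▸ Inc.edge_mem he, he⟩
  refine ⟨hends ▸ G'.ends_finite hEfin, ?_⟩
  obtain ⟨h, hh, hgood⟩ := hG.exists_forall_ncard_le hV h5
  obtain ⟨v, hv, hvh⟩ := Set.exists_ne_of_one_lt_ncard (by omega : 1 < V(G).ncard) h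
  have hgv := hgood v hv hvh
  have h3 := hG.three_le_ncard_incidenceSet hV hv
  -- A basis avoiding `e`: since `v` is good, `n - 1` suitable edges away from `v` remain without
  -- `e`, and `v` has an edge other than `e`. Thus the whole matroid has no coloops.
  have hex : ∀ e, ∃ J ⊆ E(G) \ {e}, G.bicircularMatroid.Indep J ∧ J.ncard = V(G).ncard := by
    intro e
    obtain ⟨I, hI, hIc, hIf⟩ := hG.exists_indep_insert hV hv (D := {e})
      Set.subsingleton_singleton (by
        have := Set.pred_ncard_le_ncard_sdiff_singleton (E(G) \ G.incidenceSet v) e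
        omega)
    obtain ⟨f, hf, hfe⟩ := Set.exists_ne_of_one_lt_ncard
      (by omega : 1 < (G.incidenceSet v).ncard) e
    refine ⟨insert f I, Set.insert_subset ⟨Inc.edge_mem hf, hfe⟩
      (hI.trans (Set.sdiff_subset_sdiff_left Set.sdiff_subset)), hIf f hf, ?_⟩
    rw [Set.ncard_insert_of_notMem (fun h ↦ (hI h).1.2 hf)
      (hEfin.subset (hI.trans (Set.sdiff_subset.trans Set.sdiff_subset))), hIc]
  have he₀ : E(G).Nonempty := by
    obtain ⟨e, he⟩ := Set.nonempty_of_ncard_ne_zero (by omega : (G.incidenceSet v).ncard ≠ 0)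
    exact ⟨e, Inc.edge_mem he⟩
  obtain ⟨J, hJ, hJi, hJc⟩ := hex he₀.some
  rw [← hends]
  refine G'.ncard_ends_eq_of_forall_exists_indep hEfin hE.subset (hJ.trans Set.sdiff_subset)
    (hM ▸ hJi) hJc (fun K hK hKi ↦ ?_) (fun e _ ↦ hM ▸ hex e)
  rw [← hM] at hKi
  exact ncard_le_of_indep_of_ends_subset hKi hEfin hV hK fun x ⟨e, _, hx⟩ ↦ hx.vertex_mem

/-- A vertex `v` of a `3`-connected graph such that deleting it leaves more edges than vertices can
be recognized in every graph with the same bicircular matroid. -/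
lemma IsVertexConnected.exists_incidenceSet_eq {G : Graph α β} [G.Simple]
    (hG : G.IsVertexConnected 3) (hV : V(G).Finite) {G' : Graph α' β} (hV' : V(G').Finite)
    (hcard : V(G').ncard = V(G).ncard) (hM : G.bicircularMatroid = G'.bicircularMatroid)
    {v : α} (hv : v ∈ V(G)) (hgood : V(G).ncard ≤ (E(G) \ G.incidenceSet v).ncard) :
    ∃ v' ∈ V(G'), G'.incidenceSet v' = G.incidenceSet v := by
  have hE : E(G) = E(G') := congrArg Matroid.E hM
  have hEfin := G.edgeSet_finite_of_simple hV
  have hvc := Set.ncard_sdiff_singleton_add_one hv hV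
  have hvc' := Set.ncard_pos hV |>.2 ⟨v, hv⟩
  obtain ⟨f₀, hf₀⟩ : (G.incidenceSet v).Nonempty :=
    Set.nonempty_of_ncard_ne_zero (by have := hG.three_le_ncard_incidenceSet hV hv; omega)
  have hex : ∀ e, ∃ I ⊆ (E(G) \ G.incidenceSet v) \ {e}, I.ncard + 1 = V(G).ncard ∧
      ∀ f, G.Inc f v → G.bicircularMatroid.Indep (insert f I) := fun e ↦
    hG.exists_indep_insert hV hv (D := {e}) Set.subsingleton_singleton (by
      have := Set.pred_ncard_le_ncard_sdiff_singleton (E(G) \ G.incidenceSet v) e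
      omega)
  -- Excluding `f₀` costs nothing, as it lies at `v`. Any basis of the edges avoiding `v` would do.
  obtain ⟨I, hI, hIc, hIf⟩ := hex f₀
  have hends : (G'.ends (E(G) \ G.incidenceSet v)).ncard = V(G).ncard - 1 := by
    refine G'.ncard_ends_eq_of_forall_exists_indep hEfin.sdiff (Set.sdiff_subset.trans hE.subset)
      (hI.trans Set.sdiff_subset) (hM ▸ (hIf f₀ hf₀).subset (Set.subset_insert _ _)) (by omega)
      (fun K hK hKi ↦ ?_) (fun e _ ↦ ?_)
    · rw [← hM] at hKi
      have := ncard_le_of_indep_of_ends_subset hKi hEfin.sdiff (hV.sdiff (t := {v})) hK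
        (fun x ⟨e, he, hx⟩ ↦ ⟨hx.vertex_mem, by rintro rfl; exact he.2 hx⟩)
      omega
    · obtain ⟨J, hJ, hJc, hJf⟩ := hex e
      exact ⟨J, hJ, hM ▸ (hJf f₀ hf₀).subset (Set.subset_insert _ _), by omega⟩
  obtain ⟨v', hv', hv'n⟩ : ∃ v' ∈ V(G'), v' ∉ G'.ends (E(G) \ G.incidenceSet v) := by
    by_contra! h
    have := Set.ncard_le_ncard h (G'.ends_finite hEfin.sdiff)
    omega
  refine ⟨v', hv', Set.Subset.antisymm (fun e he ↦ ?_) fun f hf ↦ ?_⟩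
  · by_contra hne
    exact hv'n ⟨e, ⟨hE ▸ Inc.edge_mem he, hne⟩, he⟩
  · by_contra hne
    have hi := hIf f hf
    rw [hM] at hi
    have hIfin : I.Finite := hEfin.subset (hI.trans (Set.sdiff_subset.trans Set.sdiff_subset))
    -- If `f` missed `v'`, the `n` independent edges of `insert f I` would have at most `n - 1` ends
    -- in `G'`.
    have h1 := ncard_le_of_indep_of_ends_subset hi (hIfin.insert f) (hV'.sdiff (t := {v'}))
      subset_rfl (by
        rintro x ⟨e, he, hx⟩
        refine ⟨hx.vertex_mem, ?_⟩
        rintro rfl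
        obtain rfl | he := he
        · exact hne hx
        · exact hv'n ⟨e, (hI he).1, hx⟩)
    rw [Set.ncard_insert_of_notMem (fun h ↦ (hI h).1.2 hf) hIfin] at h1
    have := Set.ncard_sdiff_singleton_add_one hv' hV'
    omega

/-- Graphs with equal incidences along a bijection of their vertex sets are strongly isomorphic. -/
lemma stronglyIsomorphic_of_bijOn {G : Graph α β} {G' : Graph α' β} (hE : E(G) = E(G'))
    {φ : α → α'} (hφ : Set.BijOn φ V(G) V(G'))
    (hinc : ∀ x ∈ V(G), ∀ e, G.Inc e x ↔ G'.Inc e (φ x)) : G.StronglyIsomorphic G' := by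
  refine ⟨hE, hφ.equiv, fun e x y ↦ ?_⟩
  change G.IsLink e x y ↔ G'.IsLink e (φ x) (φ y)
  rw [isLink_iff_inc, isLink_iff_inc, hinc x x.2, hinc y y.2]
  refine and_congr_right fun _ ↦ and_congr_right fun _ ↦ ⟨fun h z hz ↦ ?_, fun h z hz ↦ ?_⟩
  · obtain ⟨w, hw, rfl⟩ := hφ.surjOn hz.vertex_mem
    exact (h w ((hinc w hw e).2 hz)).imp (congrArg φ) (congrArg φ)
  · have hzV := hz.vertex_mem
    exact (h (φ z) ((hinc z hzV e).1 hz)).imp (fun h ↦ hφ.injOn hzV x.2 h)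
      (fun h ↦ hφ.injOn hzV y.2 h)

/-- A `3`-connected graph with at least five vertices is determined by its bicircular matroid. -/
theorem IsVertexConnected.stronglyIsomorphic_of_five_le {G : Graph α β} [G.Simple]
    (hG : G.IsVertexConnected 3) (hV : V(G).Finite) (h5 : 5 ≤ V(G).ncard) {G' : Graph α' β}
    (hiso : G'.NoIsolated) (hM : G.bicircularMatroid = G'.bicircularMatroid) :
    G.StronglyIsomorphic G' := by
  classical
  have hE : E(G) = E(G') := congrArg Matroid.E hM
  have hEfin := G.edgeSet_finite_of_simple hV
  obtain ⟨hV', hcard⟩ := hG.ncard_vertexSet_eq hV h5 hiso hM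
  obtain ⟨h, hh, hgood⟩ := hG.exists_forall_ncard_le hV h5
  have hstar : ∀ v ∈ V(G) \ {h}, ∃ v' ∈ V(G'), G'.incidenceSet v' = G.incidenceSet v :=
    fun v hv ↦ hG.exists_incidenceSet_eq hV hV' hcard hM hv.1 (hgood v hv.1 hv.2)
  have : Nonempty α' := by
    obtain ⟨x, -⟩ := (Set.ncard_pos hV').1 (by omega)
    exact ⟨x⟩
  choose! ν hνV hν using hstar
  have hinc : ∀ v ∈ V(G), v ≠ h → ∀ e, G.Inc e v ↔ G'.Inc e (ν v) := fun v hv hvh e ↦ by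
    rw [← mem_incidenceSet, ← mem_incidenceSet, hν v ⟨hv, hvh⟩]
  -- Two vertices with the same star would be joined by all of its edges, at least three, contrary
  -- to simplicity.
  have hinj : Set.InjOn ν (V(G) \ {h}) := by
    intro x hx y hy hxy
    by_contra hne
    have heq : G.incidenceSet x = G.incidenceSet y := by rw [← hν x hx, hxy, hν y hy]
    obtain ⟨e, he, f, hf, hef⟩ := (Set.one_lt_ncard
      (hEfin.subset (G.incidenceSet_subset_edgeSet x))).1
      (by have := hG.three_le_ncard_incidenceSet hV hx.1; omega)
    have hl : ∀ g ∈ G.incidenceSet x, G.IsLink g x y := by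
      intro g hg
      have hgy : G.Inc g y := by rwa [heq] at hg
      obtain ⟨z, hz⟩ := hg
      rwa [hgy.eq_of_isLink_of_ne_left hz (Ne.symm hne)]
    exact hef ((hl e he).eq (hl f hf))
  have himg : (ν '' (V(G) \ {h})).ncard + 1 = V(G').ncard := by
    rw [hinj.ncard_image, Set.ncard_sdiff_singleton_add_one hh hV, hcard]
  obtain ⟨h', hh', hh'n⟩ : ∃ h' ∈ V(G'), h' ∉ ν '' (V(G) \ {h}) := by
    by_contra! hcon
    have := Set.ncard_le_ncard hcon (hV.sdiff.image ν)
    omega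
  have hne' : ∀ x ∈ V(G), x ≠ h → ν x ≠ h' := fun x hx hxh hx' ↦ hh'n ⟨x, ⟨hx, hxh⟩, hx'⟩
  -- An edge avoiding `h` already has two distinct ends in `G'`, the images of its ends in `G`, so
  -- there is no room for `h'`.
  have hout : ∀ e ∈ E(G), ¬ G.Inc e h → ¬ G'.Inc e h' := by
    intro e he heh heh'
    obtain ⟨x, y, hxy⟩ := G.exists_isLink_of_mem_edgeSet he
    have hxh : x ≠ h := by rintro rfl; exact heh hxy.inc_left
    have hyh : y ≠ h := by rintro rfl; exact heh hxy.inc_right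
    have hx' := (hinc x hxy.left_mem hxh e).1 hxy.inc_left
    have hy' := (hinc y hxy.right_mem hyh e).1 hxy.inc_right
    obtain h1 | h1 | h1 := hx'.eq_or_eq_or_eq hy' heh'
    · exact hxy.ne (hinj ⟨hxy.left_mem, hxh⟩ ⟨hxy.right_mem, hyh⟩ h1)
    · exact hne' x hxy.left_mem hxh h1
    · exact hne' y hxy.right_mem hyh h1
  have hinch : ∀ e, G.Inc e h ↔ G'.Inc e h' := by
    refine fun e ↦ ⟨fun he ↦ ?_, fun he ↦ ?_⟩
    · by_contra hne
      -- Since `h` need not be good, only `n - 1` edges avoiding it are guaranteed. They suffice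
      -- with `D = ∅`, because `hout` replaces the coloop argument.
      obtain ⟨I, hI, hIc, hIf⟩ := hG.exists_indep_insert hV hh (D := ∅)
        Set.subsingleton_empty (by simpa using hG.ncard_le_ncard_sdiff_incidenceSet hV hh)
      rw [Set.sdiff_empty] at hI
      have hi := hIf e he
      rw [hM] at hi
      have hIfin : I.Finite := hEfin.subset (hI.trans Set.sdiff_subset)
      have h1 := ncard_le_of_indep_of_ends_subset hi (hIfin.insert e) (hV'.sdiff (t := {h'}))
        subset_rfl (by
          rintro x ⟨f, hf, hx⟩
          refine ⟨hx.vertex_mem, ?_⟩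
          rintro rfl
          obtain rfl | hf := hf
          · exact hne hx
          · exact hout f (hI hf).1 (hI hf).2 hx)
      rw [Set.ncard_insert_of_notMem (fun h ↦ (hI h).2 he) hIfin] at h1
      have := Set.ncard_sdiff_singleton_add_one hh' hV'
      omega
    · by_contra hne
      exact hout e (hE ▸ he.edge_mem) hne he
  have hφ : ∀ x, x ≠ h → Function.update ν h h' x = ν x := fun x hx ↦ by simp [hx]
  have hφh : Function.update ν h h' h = h' := by simp
  have hφinj : Set.InjOn (Function.update ν h h') V(G) := by
    intro x hx y hy hxy
    by_cases hxh : x = h <;> by_cases hyh : y = h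
    · rw [hxh, hyh]
    · subst hxh
      rw [hφh, hφ y hyh] at hxy
      exact absurd hxy.symm (hne' y hy hyh)
    · subst hyh
      rw [hφh, hφ x hxh] at hxy
      exact absurd hxy (hne' x hx hxh)
    · rw [hφ x hxh, hφ y hyh] at hxy
      exact hinj ⟨hx, hxh⟩ ⟨hy, hyh⟩ hxy
  have hφmaps : Set.MapsTo (Function.update ν h h') V(G) V(G') := by
    intro x hx
    by_cases hxh : x = h
    · rwa [hxh, hφh]
    · rw [hφ x hxh]
      exact hνV x ⟨hx, hxh⟩
  refine stronglyIsomorphic_of_bijOn hE ⟨hφmaps, hφinj, ?_⟩ (fun x hx e ↦ ?_)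
  · refine (Set.eq_of_subset_of_ncard_le hφmaps.image_subset ?_ hV').superset
    rw [hφinj.ncard_image, hcard]
  · by_cases hxh : x = h
    · rw [hxh, hφh]
      exact hinch e
    · rw [hφ x hxh]
      exact hinc x hx hxh e

/-! ### The case of four vertices -/

/-- A `3`-connected simple graph with four vertices is complete. -/
lemma IsVertexConnected.exists_isLink_of_ncard_eq_four {G : Graph α β} [G.Simple]
    (hG : G.IsVertexConnected 3) (hV : V(G).Finite) (h4 : V(G).ncard = 4) {x y : α}
    (hx : x ∈ V(G)) (hy : y ∈ V(G)) (hxy : x ≠ y) : ∃ e, G.IsLink e x y := by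
  by_contra! hcon
  have hd := hG.three_le_ncard_incidenceSet hV hx
  have hlink : ∀ e ∈ G.incidenceSet x, ∃ z, G.IsLink e x z := fun e he ↦ he
  have : Nonempty α := ⟨x⟩
  choose! g hg using hlink
  -- The far ends of the three or more edges at `x` are distinct and avoid `x` and `y`, but only two
  -- vertices are left.
  have h1 : (G.incidenceSet x).ncard ≤ ((V(G) \ {x}) \ {y}).ncard := by
    refine Set.ncard_le_ncard_of_injOn g (fun e he ↦ ⟨⟨(hg e he).right_mem, ?_⟩, ?_⟩) ?_
      hV.sdiff.sdiff
    · exact (hg e he).ne.symm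
    · rintro rfl
      exact hcon e (hg e he)
    · intro e he f hf hef
      have := hg f hf
      rw [← hef] at this
      exact (hg e he).eq this
  have h2 := Set.ncard_sdiff_singleton_add_one hx hV
  have h3 := Set.ncard_sdiff_singleton_add_one (s := V(G) \ {x}) ⟨hy, hxy.symm⟩ hV.sdiff
  omega

/-- A `3`-connected simple graph with four vertices is isomorphic to `K₄`. -/
lemma IsVertexConnected.isomorphic_completeGraph_four {G : Graph α β} [G.Simple]
    (hG : G.IsVertexConnected 3) (hV : V(G).Finite) (h4 : V(G).ncard = 4) :
    G.Isomorphic (ofSimpleGraph (⊤ : SimpleGraph (Fin 4))) := by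
  have : Finite V(G) := hV
  obtain ⟨μ⟩ : Nonempty (V(G) ≃ Fin 4) := ⟨Finite.equivFinOfCardEq h4⟩
  have hl : ∀ e : E(G), ∃ p : V(G) × V(G), G.IsLink e p.1 p.2 := by
    intro e
    obtain ⟨x, y, hxy⟩ := G.exists_isLink_of_mem_edgeSet e.2
    exact ⟨(⟨x, hxy.left_mem⟩, ⟨y, hxy.right_mem⟩), hxy⟩
  choose p hp using hl
  have hpne : ∀ e, (p e).1 ≠ (p e).2 := fun e h ↦ (hp e).ne (congrArg Subtype.val h)
  have hiff : ∀ (e : E(G)) (x y : V(G)),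
      G.IsLink e x y ↔ s(μ (p e).1, μ (p e).2) = s(μ x, μ y) := by
    intro e x y
    rw [(hp e).isLink_iff]
    simp [Subtype.ext_iff]
  let ε : E(G) → E(ofSimpleGraph (⊤ : SimpleGraph (Fin 4))) := fun e ↦
    ⟨s(μ (p e).1, μ (p e).2), by simpa using hpne e⟩
  -- Injectivity is the absence of parallel edges; surjectivity is completeness.
  have hε : Function.Bijective ε := by
    constructor
    · intro e f hef
      have h1 := (hiff e _ _).2 ((congrArg Subtype.val hef).trans ((hiff f _ _).1 (hp f)))
      exact Subtype.ext (h1.eq (hp f))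
    · rintro ⟨q, hq⟩
      induction q with | h a b =>
      have hab : a ≠ b := by simpa using hq
      obtain ⟨e, he⟩ := hG.exists_isLink_of_ncard_eq_four hV h4 (μ.symm a).2 (μ.symm b).2
        (fun h ↦ hab (μ.symm.injective (Subtype.ext h)))
      refine ⟨⟨e, he.edge_mem⟩, Subtype.ext ?_⟩
      have h1 := (hiff ⟨e, he.edge_mem⟩ _ _).1 he
      rwa [μ.apply_symm_apply, μ.apply_symm_apply] at h1
  refine ⟨μ.trans (Equiv.Set.univ _).symm, Equiv.ofBijective ε hε, fun e x y ↦ ?_⟩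
  rw [hiff]
  exact ⟨fun h ↦ ⟨h, (ε e).2⟩, fun h ↦ h.1⟩

end Graph

/-- Every finite (simple) 3-connected graph `G` that is not isomorphic to `K₄` is uniquely defined
by its bicircular matroid: every multigraph `G'` without isolated vertices that has the same
bicircular matroid is strongly isomorphic to `G`. -/
theorem mainTheorem2 {α α' β : Type*} (G : Graph α β) (hfin : V(G).Finite)
    (hsimple : G.Simple) (hconn : G.IsVertexConnected 3)
    (hK4 : ¬ G.Isomorphic (Graph.ofSimpleGraph (⊤ : SimpleGraph (Fin 4))))
    (G' : Graph α' β) (hiso : G'.NoIsolated)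
    (hM : G.bicircularMatroid = G'.bicircularMatroid) :
    G.StronglyIsomorphic G' := by
  have h3 := hconn.three_lt_ncard hfin
  obtain h4 | h5 : V(G).ncard = 4 ∨ 5 ≤ V(G).ncard := by omega
  · exact absurd (hconn.isomorphic_completeGraph_four hfin h4) hK4
  · exact hconn.stronglyIsomorphic_of_five_le hfin h5 hiso hM
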